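/- Let $\lambda/\mu$ be a skew shape, i.e. a pair of partitions $\mu\subseteq\lambda$, that is a ribbon (border strip), meaning that its Young diagram contains no $2\times 2$ square of boxes. Its cell poset $P_{\lambda/\mu}$ is the set of boxes $\{(i,j): \mu_i<j\le\lambda_i\}$ with the partial order whose covering relations are $(i,j)\succ(i+1,j)$ and $(i,j)\succ(i,j+1)$, whenever both boxes lie in $\lambda/\mu$. A poset isomorphic to such a $P_{\lambda/\mu}$ is called a fence poset. For a finite poset $P$, the order polynomial $\Omega(P;t)\in\mathbb{Q}[t]$ is the unique polynomial whose value at every positive integer $t$ is the number of order preserving maps $f\colon P\to\{1<2<\dots<t\}$, that is, maps with $f(x)\le f(y)$ whenever $x\preceq y$. For every fence poset $P$, all coefficients of $\Omega(P;t)$ are nonnegative. -/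

import Mathlib

/-! ### The order polynomial of a finite poset -/

/-- The number of order preserving maps from `P` to a chain with `t` elements
(`Fin t` is the chain `1 < 2 < ⋯ < t`, up to a shift of the labels). -/
noncomputable def orderCount (P : Type*) [PartialOrder P] (t : ℕ) : ℕ :=
  Nat.card (P →o Fin t)

/-- The number of surjective order preserving maps from `P` to a chain with `k` elements. -/
noncomputable def surjOrderCount (P : Type*) [PartialOrder P] (k : ℕ) : ℕ :=
  Nat.card {f : P →o Fin k // Function.Surjective f}

theorem orderCount_eq_sum (P : Type*) [PartialOrder P] [Finite P] (t : ℕ) :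
    orderCount P t =
      ∑ k ∈ Finset.range (Nat.card P + 1), t.choose k * surjOrderCount P k := by
  classical
  have := Fintype.ofFinite P
  have : Finite (P →o Fin t) := DFunLike.finite _
  have : Fintype (P →o Fin t) := Fintype.ofFinite _
  have key : ∀ S : Finset (Fin t),
      (Finset.univ.filter fun f : P →o Fin t => Finset.univ.image f = S).card
        = surjOrderCount P S.card := by
    intro S
    rw [← Fintype.card_subtype, ← Nat.card_eq_fintype_card, surjOrderCount]
    have hm : ∀ f : P →o Fin t, Finset.univ.image f = S → ∀ x, f x ∈ S := by
      intro f hf x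
      rw [← hf]
      exact Finset.mem_image_of_mem _ (Finset.mem_univ x)
    let e := S.orderIsoOfFin rfl
    refine Nat.card_congr
      { toFun := fun f => ⟨⟨fun x => e.symm ⟨f.1 x, hm f.1 f.2 x⟩, ?_⟩, ?_⟩
        invFun := fun g => ⟨⟨fun x => (e (g.1 x) : Fin t), ?_⟩, ?_⟩
        left_inv := ?_
        right_inv := ?_ }
    · intro x y hxy
      exact e.symm.monotone (Subtype.mk_le_mk.2 (f.1.monotone hxy))
    · intro k
      have hk : ((e k : Fin t)) ∈ Finset.univ.image f.1 := by
        rw [f.2]; exact (e k).2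
      obtain ⟨x, -, hx⟩ := Finset.mem_image.1 hk
      refine ⟨x, ?_⟩
      show e.symm ⟨f.1 x, _⟩ = k
      rw [OrderIso.symm_apply_eq]
      exact Subtype.ext hx
    · intro x y hxy
      exact e.monotone (g.1.monotone hxy)
    · ext s
      simp only [Finset.mem_image, Finset.mem_univ, true_and]
      constructor
      · rintro ⟨x, rfl⟩
        exact (e (g.1 x)).2
      · intro hs
        obtain ⟨x, hx⟩ := g.2 (e.symm ⟨s, hs⟩)
        refine ⟨x, ?_⟩
        show (e (g.1 x) : Fin t) = s
        rw [hx, OrderIso.apply_symm_apply]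
    · intro f
      apply Subtype.ext
      ext x : 2
      show ((e (e.symm ⟨f.1 x, _⟩)) : Fin t) = f.1 x
      rw [OrderIso.apply_symm_apply]
    · intro g
      apply Subtype.ext
      ext x : 2
      show e.symm ⟨(e (g.1 x) : Fin t), _⟩ = g.1 x
      exact e.symm_apply_apply _
  have hzero : ∀ k, Nat.card P < k → surjOrderCount P k = 0 := by
    intro k hk
    rw [surjOrderCount, Nat.card_eq_zero]
    left
    constructor
    rintro ⟨f, hf⟩
    have := Nat.card_le_card_of_surjective f hf
    simp only [Nat.card_eq_fintype_card, Fintype.card_fin] at this hk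
    omega
  have h1 : orderCount P t = ∑ k ∈ Finset.range (t + 1), t.choose k * surjOrderCount P k := by
    rw [orderCount, Nat.card_eq_fintype_card, ← Finset.card_univ,
      Finset.card_eq_sum_card_fiberwise
        (f := fun f : P →o Fin t => Finset.univ.image f)
        (t := (Finset.univ : Finset (Fin t)).powerset) (by intro f _; simp)]
    rw [Finset.sum_congr rfl fun S _ => key S,
      Finset.sum_powerset_apply_card (fun k => surjOrderCount P k)]
    simp
  rw [h1]
  have h2 : ∀ a b : ℕ, a ≤ b →
      (∀ k, a < k → t.choose k * surjOrderCount P k = 0) →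
      ∑ k ∈ Finset.range (a + 1), t.choose k * surjOrderCount P k =
        ∑ k ∈ Finset.range (b + 1), t.choose k * surjOrderCount P k := by
    intro a b hab h
    apply Finset.sum_subset
    · intro k hk
      simp only [Finset.mem_range] at hk ⊢
      omega
    · intro k _ hk
      simp only [Finset.mem_range] at hk
      exact h k (by omega)
  rcases le_total t (Nat.card P) with h | h
  · exact h2 _ _ h fun k hk => by rw [Nat.choose_eq_zero_of_lt hk, zero_mul]
  · exact (h2 _ _ h fun k hk => by rw [hzero k hk, mul_zero]).symm

theorem existsUnique_orderPolynomial (P : Type*) [PartialOrder P] [Finite P] :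
    ∃! Ω : Polynomial ℚ, ∀ t : ℕ, 0 < t → Ω.eval (t : ℚ) = (orderCount P t : ℚ) := by
  refine ⟨∑ k ∈ Finset.range (Nat.card P + 1),
    Polynomial.C ((surjOrderCount P k : ℚ) / (k.factorial : ℚ)) * descPochhammer ℚ k, ?_, ?_⟩
  · intro t _
    rw [orderCount_eq_sum, Polynomial.eval_finsetSum]
    push_cast
    refine Finset.sum_congr rfl fun k _ => ?_
    rw [Polynomial.eval_mul, Polynomial.eval_C, descPochhammer_eval_eq_descFactorial,
      Nat.descFactorial_eq_factorial_mul_choose]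
    have : (k.factorial : ℚ) ≠ 0 := by exact_mod_cast k.factorial_ne_zero
    push_cast
    field_simp
  · intro Q hQ
    apply Polynomial.eq_of_infinite_eval_eq
    refine Set.Infinite.mono (s := (fun t : ℕ => (t : ℚ)) '' Set.Ioi 0) ?_ ?_
    · rintro _ ⟨t, ht, rfl⟩
      rw [Set.mem_ofPred_eq, hQ t ht]
      rw [orderCount_eq_sum, Polynomial.eval_finsetSum]
      push_cast
      refine Finset.sum_congr rfl fun k _ => ?_
      rw [Polynomial.eval_mul, Polynomial.eval_C, descPochhammer_eval_eq_descFactorial,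
        Nat.descFactorial_eq_factorial_mul_choose]
      have : (k.factorial : ℚ) ≠ 0 := by exact_mod_cast k.factorial_ne_zero
      push_cast
      field_simp
    · exact (Set.Ioi_infinite 0).image Nat.cast_injective.injOn

/-- The order polynomial `Ω(P; t)` of a finite poset `P`: the unique polynomial with rational
coefficients whose value at every positive integer `t` is the number of order preserving maps
from `P` to a chain with `t` elements. -/
noncomputable def orderPolynomial (P : Type*) [PartialOrder P] [Finite P] : Polynomial ℚ :=
  (existsUnique_orderPolynomial P).choose

/-! ### Skew shapes, cell posets and fences -/

/-- A skew shape `λ/μ`: two Young diagrams (partitions) `μ ⊆ λ`. -/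
structure SkewShape where
  /-- the partition `λ` -/
  outer : YoungDiagram
  /-- the partition `μ` -/
  inner : YoungDiagram
  inner_le_outer : inner ≤ outer

namespace SkewShape

/-- The boxes of `λ/μ`; as for Young diagrams in English notation, `(i, j)` is the box in row `i`
and column `j`, rows being numbered downward and columns rightward. -/
def cells (s : SkewShape) : Finset (ℕ × ℕ) := s.outer.cells \ s.inner.cells

/-- The underlying set of the cell poset `P_{λ/μ}`: the boxes of `λ/μ`. -/
def CellPoset (s : SkewShape) : Type := {c : ℕ × ℕ // c ∈ s.cells}

instance (s : SkewShape) : Finite s.CellPoset :=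
  inferInstanceAs (Finite {c : ℕ × ℕ // c ∈ s.cells})

/-- `y` is the box immediately below `x`, or the box immediately to the right of `x`. -/
def IsNext (s : SkewShape) (x y : s.CellPoset) : Prop :=
  y.1 = (x.1.1 + 1, x.1.2) ∨ y.1 = (x.1.1, x.1.2 + 1)

theorem le_of_reflTransGen (s : SkewShape) {x y : s.CellPoset}
    (h : Relation.ReflTransGen s.IsNext x y) : x.1 ≤ y.1 := by
  induction h with
  | refl => exact le_rfl
  | tail _ h ih =>
    refine ih.trans ?_
    rcases h with h | h <;> rw [h] <;> exact Prod.mk_le_mk.2 ⟨by simp, by simp⟩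

/-- The cell poset `P_{λ/μ}`: the partial order on the boxes whose covering relations are that
`(i, j)` lies above `(i + 1, j)` and above `(i, j + 1)`. -/
instance (s : SkewShape) : PartialOrder s.CellPoset where
  le y x := Relation.ReflTransGen s.IsNext x y
  le_refl _ := Relation.ReflTransGen.refl
  le_trans _ _ _ h₁ h₂ := h₂.trans h₁
  le_antisymm _ _ h₁ h₂ :=
    Subtype.ext (le_antisymm (s.le_of_reflTransGen h₂) (s.le_of_reflTransGen h₁))

/-- A skew shape is a ribbon (border strip) if it does not contain a `2 × 2` square of boxes. -/
def IsRibbon (s : SkewShape) : Prop :=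
  ∀ i j : ℕ, ¬ ((i, j) ∈ s.cells ∧ (i, j + 1) ∈ s.cells ∧
    (i + 1, j) ∈ s.cells ∧ (i + 1, j + 1) ∈ s.cells)

end SkewShape

/-- A fence poset is a poset that is (isomorphic to) the cell poset of a ribbon. -/
def IsFencePoset (P : Type*) [PartialOrder P] : Prop :=
  ∃ s : SkewShape, s.IsRibbon ∧ Nonempty (P ≃o s.CellPoset)

/-! Contents order a ribbon's boxes along the integers and turn it into a disjoint union of zigzag
paths, a class closed under passing to subsets. Write F_S for the counting polynomial of a finite
set S of integers. Cutting a chain of s + t elements after the first s gives F_S(s + t) = ∑ F_I(s)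
F_{S \ I}(t) over the lower parts I of S (`relCountOn_add`). Extracting the coefficient of s yields
F_S' = ∑ [s]F_I · F_{S \ I}. So by induction on S everything reduces to nonnegative linear
coefficients.

For a single path these are explicit (`exists_zigzag_polynomial`): with m ascents and d descents the
coefficient is m! d! / (m + d + 1)!, whatever their order. A nonempty path has zero constant term,
so a union of several paths has zero linear coefficient. -/

/-! ### Counting zigzag sequences -/

/-- The number of ways to continue `x` to a sequence with values in `{0, …, t - 1}` whose
successive steps are weak ascents (`true`) or weak descents (`false`) as prescribed by a word. -/
def zigzagFrom (t : ℕ) : List Bool → ℕ → ℕ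
  | [], _ => 1
  | true :: w, x => ∑ y ∈ Finset.Ico x t, zigzagFrom t w y
  | false :: w, x => ∑ y ∈ Finset.range (x + 1), zigzagFrom t w y

/-- The number of sequences with values in `{0, …, t - 1}` following a word of weak ascents and
descents. -/
def zigzagCount (w : List Bool) (t : ℕ) : ℕ := ∑ x ∈ Finset.range t, zigzagFrom t w x

/-- Allowing either direction at one step leaves the two sides independent, except that an equality
there is counted twice; contracting the equal pair gives the word `p ++ q`. -/
theorem zigzagFrom_ascent_add_descent (t : ℕ) (p q : List Bool) {x : ℕ} (hx : x < t) :
    zigzagFrom t (p ++ true :: q) x + zigzagFrom t (p ++ false :: q) x =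
      zigzagFrom t p x * zigzagCount q t + zigzagFrom t (p ++ q) x := by
  induction p generalizing x with
  | nil =>
    simp only [List.nil_append, zigzagFrom, zigzagCount, one_mul]
    rw [Finset.sum_range_succ, ← Finset.sum_range_add_sum_Ico _ hx.le]
    ring
  | cons b p ih =>
    cases b <;> simp only [List.cons_append, zigzagFrom] <;>
      rw [← Finset.sum_add_distrib, Finset.sum_mul, ← Finset.sum_add_distrib] <;>
      refine Finset.sum_congr rfl fun y hy => ih ?_
    · simp only [Finset.mem_range] at hy; omega
    · exact (Finset.mem_Ico.1 hy).2

theorem zigzagCount_ascent_add_descent (t : ℕ) (p q : List Bool) :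
    zigzagCount (p ++ true :: q) t + zigzagCount (p ++ false :: q) t =
      zigzagCount p t * zigzagCount q t + zigzagCount (p ++ q) t := by
  simp only [zigzagCount, Finset.sum_mul, ← Finset.sum_add_distrib]
  exact Finset.sum_congr rfl fun x hx =>
    zigzagFrom_ascent_add_descent t p q (Finset.mem_range.1 hx)

theorem zigzagFrom_replicate_false (t m x : ℕ) :
    zigzagFrom t (List.replicate m false) x = (x + m).choose m := by
  induction m generalizing x with
  | zero => simp [zigzagFrom]
  | succ m ih =>
    simp only [List.replicate_succ, zigzagFrom, ih]
    rw [Nat.sum_range_add_choose, add_assoc]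

theorem zigzagCount_replicate_false (t m : ℕ) :
    zigzagCount (List.replicate m false) t = (t + m).choose (m + 1) := by
  simp only [zigzagCount, zigzagFrom_replicate_false]
  cases t with
  | zero => simp
  | succ t => rw [Nat.sum_range_add_choose]; congr 1; omega

open Polynomial in
/-- The number of zigzag sequences is a polynomial in the number of admissible values, with
linear coefficient `m! d! / (m + d + 1)!` for `m` ascents and `d` descents. -/
theorem exists_zigzag_polynomial (w : List Bool) :
    ∃ f : ℚ[X], (∀ t : ℕ, f.eval (t : ℚ) = zigzagCount w t) ∧ f.coeff 0 = 0 ∧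
      f.coeff 1 = ((w.count true).factorial * (w.count false).factorial : ℚ) /
        (w.count true + w.count false + 1).factorial := by
  -- Solving the ascent/descent identity for the word with the ascent leaves only words with fewer
  -- ascents; pure descents are the base case.
  induction h : w.count true using Nat.strong_induction_on generalizing w with
  | _ n ih =>
  by_cases hw : true ∈ w
  · obtain ⟨p, q, rfl⟩ := List.append_of_mem hw
    subst h
    obtain ⟨f₁, h₁, z₁, -⟩ := ih (p.count true) (by simp) p rfl
    obtain ⟨f₂, h₂, z₂, -⟩ := ih (q.count true) (by simp; omega) q rfl
    obtain ⟨f₃, h₃, z₃, l₃⟩ := ih ((p ++ q).count true) (by simp) _ rfl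
    obtain ⟨f₄, h₄, z₄, l₄⟩ := ih ((p ++ false :: q).count true) (by simp) _ rfl
    refine ⟨f₁ * f₂ + f₃ - f₄, fun t => ?_, ?_, ?_⟩
    · have := zigzagCount_ascent_add_descent t p q
      simp only [eval_sub, eval_add, eval_mul, h₁, h₂, h₃, h₄]
      rw [sub_eq_iff_eq_add]
      exact_mod_cast this.symm
    · simp [mul_coeff_zero, z₁, z₃, z₄]
    -- The product has no linear term. What remains is a! b! / (a+b+1)! - a! (b+1)! / (a+b+2)! =
    -- (a+1)! b! / (a+b+2)!.
    · rw [coeff_sub, coeff_add, mul_coeff_one, z₁, z₂, l₃, l₄]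
      simp only [List.count_append, List.count_cons_self, List.count_cons_of_ne,
        ne_eq, Bool.true_eq_false, Bool.false_eq_true, not_false_eq_true]
      rw [show List.count true p + (List.count true q + 1) =
          List.count true p + List.count true q + 1 by ring,
        show List.count false p + (List.count false q + 1) =
          List.count false p + List.count false q + 1 by ring]
      generalize List.count true p + List.count true q = a
      generalize List.count false p + List.count false q = b
      rw [show a + 1 + b + 1 = a + b + 1 + 1 by ring, show a + (b + 1) + 1 = a + b + 1 + 1 by ring,
        Nat.factorial_succ (a + b + 1), Nat.factorial_succ a, Nat.factorial_succ b]
      push_cast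
      have := (Nat.cast_ne_zero (R := ℚ)).2 (a + b + 1).factorial_ne_zero
      field_simp
      ring
  · have hrep : w = List.replicate w.length false := by
      rw [List.eq_replicate_iff]
      refine ⟨rfl, fun b hb => ?_⟩
      cases b
      · rfl
      · exact absurd hb hw
    generalize w.length = m at hrep
    subst hrep
    have hn : n = 0 := by rw [← h]; exact List.count_eq_zero.2 hw
    subst hn
    -- The binomial (t + m choose m + 1) is t(t+1)⋯(t+m) / (m+1)!, with linear coefficient m! /
    -- (m+1)!.
    refine ⟨C (((m + 1).factorial : ℚ)⁻¹) * ascPochhammer ℚ (m + 1), fun t => ?_, ?_, ?_⟩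
    · rw [zigzagCount_replicate_false, eval_mul, eval_C,
        ascPochhammer_nat_eq_natCast_ascFactorial, Nat.ascFactorial_eq_factorial_mul_choose']
      push_cast
      rw [inv_mul_cancel_left₀ (by exact_mod_cast (m + 1).factorial_ne_zero)]
      simp [← add_assoc]
    · simp [ascPochhammer_succ_left]
    · rw [coeff_C_mul, ascPochhammer_succ_left, coeff_X_mul, coeff_zero_eq_eval_zero, eval_comp]
      simp [ascPochhammer_eval_one]
      ring

/-! ### Counting maps to a chain that respect a relation -/

/-- The number of maps `a : τ → {0 < ⋯ < t - 1}` with `a x ≤ a y` whenever `R x y`. -/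
noncomputable def relCount {τ : Type*} (R : τ → τ → Prop) (t : ℕ) : ℕ :=
  Nat.card {a : τ → Fin t // ∀ x y, R x y → a x ≤ a y}

theorem relCount_congr {τ τ' : Type*} {R : τ → τ → Prop} {R' : τ' → τ' → Prop} (e : τ ≃ τ')
    (h : ∀ x y, R x y ↔ R' (e x) (e y)) (t : ℕ) : relCount R t = relCount R' t := by
  refine Nat.card_congr ((e.arrowCongr (Equiv.refl _)).subtypeEquiv fun a => ?_)
  constructor
  · intro ha x y hxy
    exact ha _ _ ((h _ _).2 (by simpa using hxy))
  · intro ha x y hxy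
    simpa using ha (e x) (e y) ((h x y).1 hxy)

section

variable {σ : Type*} (R : σ → σ → Prop)

/-- `relCount` for the restriction of a relation to a finite set. -/
noncomputable def relCountOn (S : Finset σ) (t : ℕ) : ℕ :=
  relCount (fun x y : S => R x y) t

theorem relCountOn_empty (t : ℕ) : relCountOn R ∅ t = 1 := by
  have hx : ∀ x : (∅ : Finset σ), False := fun x => Finset.notMem_empty _ x.2
  rw [relCountOn, relCount, Nat.card_eq_one_iff_unique]
  exact ⟨⟨fun a b => Subtype.ext (funext fun x => (hx x).elim)⟩,
    ⟨⟨fun x => (hx x).elim, fun x => (hx x).elim⟩⟩⟩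

variable [DecidableEq σ]

/-- If no relation links `I` to its complement, the count factors. -/
theorem relCountOn_mul {S I : Finset σ} (hI : I ⊆ S)
    (h : ∀ x ∈ I, ∀ y ∈ S \ I, ¬ R x y ∧ ¬ R y x) (t : ℕ) :
    relCountOn R S t = relCountOn R I t * relCountOn R (S \ I) t := by
  rw [relCountOn, relCountOn, relCountOn, relCount, relCount, relCount, ← Nat.card_prod]
  refine Nat.card_congr
    { toFun := fun a => (⟨fun x => a.1 ⟨x, hI x.2⟩, fun x y hxy => a.2 _ _ hxy⟩,
        ⟨fun x => a.1 ⟨x, (Finset.mem_sdiff.1 x.2).1⟩, fun x y hxy => a.2 _ _ hxy⟩)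
      invFun := fun b => ⟨fun x => if hx : x.1 ∈ I then b.1.1 ⟨x, hx⟩ else
        b.2.1 ⟨x, Finset.mem_sdiff.2 ⟨x.2, hx⟩⟩, ?_⟩
      left_inv := ?_
      right_inv := ?_ }
  · intro x y hxy
    by_cases hx : x.1 ∈ I <;> by_cases hy : y.1 ∈ I <;> simp only [hx, hy, dite_true, dite_false]
    · exact b.1.2 _ _ hxy
    · exact absurd hxy (h _ hx _ (Finset.mem_sdiff.2 ⟨y.2, hy⟩)).1
    · exact absurd hxy (h _ hy _ (Finset.mem_sdiff.2 ⟨x.2, hx⟩)).2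
    · exact b.2.2 _ _ hxy
  · intro a
    ext x
    by_cases hx : x.1 ∈ I <;> simp [hx]
  · rintro ⟨b, c⟩
    refine Prod.ext (Subtype.ext (funext fun x => ?_)) (Subtype.ext (funext fun x => ?_))
    · simp
    · have := (Finset.mem_sdiff.1 x.2).2
      simp [this]

open Classical in
/-- The subsets of `S` that are closed downward in `S` under a relation. -/
noncomputable def lowerParts (S : Finset σ) : Finset (Finset σ) :=
  S.powerset.filter fun I => ∀ x ∈ S, ∀ y ∈ I, R x y → x ∈ I

theorem mem_lowerParts {S I : Finset σ} :
    I ∈ lowerParts R S ↔ I ⊆ S ∧ ∀ x ∈ S, ∀ y ∈ I, R x y → x ∈ I := by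
  simp [lowerParts]

open Classical in
/-- Splitting a chain with `s + t` elements into its lower `s` and upper `t` elements. -/
theorem relCountOn_add (S : Finset σ) (s t : ℕ) :
    relCountOn R S (s + t) =
      ∑ I ∈ lowerParts R S, relCountOn R I s * relCountOn R (S \ I) t := by
  let A := {a : S → Fin (s + t) // ∀ x y : S, R x y → a x ≤ a y}
  -- The fibre over `I` consists of the maps sending exactly `I` into the lowest s values.
  let low : A → Finset σ := fun a => S.filter fun x => ∃ h : x ∈ S, (a.1 ⟨x, h⟩).1 < s
  have low_iff : ∀ (a : A) (x : S), x.1 ∈ low a ↔ (a.1 x).1 < s := fun a x => by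
    simp [low]
  have hcard : relCountOn R S (s + t) = (Finset.univ : Finset A).card := by
    rw [relCountOn, relCount, Nat.card_eq_fintype_card, Finset.card_univ]
  rw [hcard, Finset.card_eq_sum_card_fiberwise (f := low) (t := lowerParts R S)]
  · refine Finset.sum_congr rfl fun I hI => ?_
    obtain ⟨hI, hlow⟩ := (mem_lowerParts R).1 hI
    rw [← Fintype.card_subtype, ← Nat.card_eq_fintype_card, relCountOn, relCountOn, relCount,
      relCount, ← Nat.card_prod]
    have hlt : ∀ a : {a : A // low a = I}, ∀ x : S, x.1 ∈ I ↔ (a.1.1 x).1 < s := fun a x => by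
      rw [← low_iff, a.2]
    refine Nat.card_congr
      { toFun := fun a => (⟨fun x => ⟨a.1.1 ⟨x, hI x.2⟩, (hlt a ⟨x, hI x.2⟩).1 x.2⟩,
            fun x y hxy => a.1.2 _ _ hxy⟩,
          ⟨fun x => ⟨a.1.1 ⟨x, (Finset.mem_sdiff.1 x.2).1⟩ - s, ?_⟩, fun x y hxy => ?_⟩)
        invFun := fun b => ⟨⟨fun x => if hx : x.1 ∈ I then (b.1.1 ⟨x, hx⟩).castAdd t else
          (b.2.1 ⟨x, Finset.mem_sdiff.2 ⟨x.2, hx⟩⟩).natAdd s, ?_⟩, ?_⟩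
        left_inv := ?_
        right_inv := ?_ }
    · have := (hlt a ⟨x, (Finset.mem_sdiff.1 x.2).1⟩).not.1 (Finset.mem_sdiff.1 x.2).2
      have := (a.1.1 ⟨x, (Finset.mem_sdiff.1 x.2).1⟩).2
      omega
    · have := a.1.2 ⟨x, (Finset.mem_sdiff.1 x.2).1⟩ ⟨y, (Finset.mem_sdiff.1 y.2).1⟩ hxy
      exact Fin.mk_le_mk.2 (Nat.sub_le_sub_right (Fin.le_def.1 this) s)
    · intro x y hxy
      by_cases hx : x.1 ∈ I <;> by_cases hy : y.1 ∈ I <;> simp only [hx, hy, dite_true, dite_false]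
      · exact b.1.2 _ _ hxy
      · rw [Fin.le_def, Fin.val_castAdd, Fin.val_natAdd]
        have := (b.1.1 ⟨x, hx⟩).2
        omega
      · exact absurd (hlow x x.2 y hy hxy) hx
      · have := b.2.2 ⟨x, Finset.mem_sdiff.2 ⟨x.2, hx⟩⟩ ⟨y, Finset.mem_sdiff.2 ⟨y.2, hy⟩⟩ hxy
        rw [Fin.le_def, Fin.val_natAdd, Fin.val_natAdd]
        exact Nat.add_le_add_left (Fin.le_def.1 this) s
    · ext x
      constructor
      · intro hx
        obtain ⟨hxS, h⟩ := Finset.mem_filter.1 hx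
        obtain ⟨_, hlt⟩ := h
        by_contra hxI
        simp [hxI] at hlt
      · intro hx
        refine Finset.mem_filter.2 ⟨hI hx, hI hx, ?_⟩
        simp [hx]
    · intro a
      refine Subtype.ext (Subtype.ext (funext fun x => Fin.ext ?_))
      by_cases hx : x.1 ∈ I
      · simp [hx]
      · have := (hlt a x).not.1 hx
        simp only [hx, dite_false, Fin.val_natAdd]
        exact Nat.add_sub_cancel' (not_lt.1 this)
    · rintro ⟨b, c⟩
      refine Prod.ext (Subtype.ext (funext fun x => Fin.ext ?_))
        (Subtype.ext (funext fun x => Fin.ext ?_))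
      · simp
      · have := (Finset.mem_sdiff.1 x.2).2
        simp [this]
  · intro a _
    refine Finset.mem_coe.2 ((mem_lowerParts R).2 ⟨Finset.filter_subset _ _,
      fun x hx y hy hxy => ?_⟩)
    have hyS : y ∈ S := (Finset.mem_filter.1 hy).1
    exact (low_iff a ⟨x, hx⟩).2
      (lt_of_le_of_lt (Fin.le_def.1 (a.2 ⟨x, hx⟩ ⟨y, hyS⟩ hxy)) ((low_iff a ⟨y, hyS⟩).1 hy))

end

/-! ### Paths of integers with prescribed ascents and descents -/

/-- The relation on `ℤ` that puts `x` below `x + 1` if `c x` holds, and `x + 1` below `x`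
otherwise. -/
def pathRel (c : ℤ → Bool) (x y : ℤ) : Prop :=
  (y = x + 1 ∧ c x = true) ∨ (x = y + 1 ∧ c y = false)

/-- The word `c k, c (k + 1), …` with `n` letters. -/
def stepWord (c : ℤ → Bool) : ℕ → ℤ → List Bool
  | 0, _ => []
  | n + 1, k => c k :: stepWord c n (k + 1)

/-- A weak ascent or a weak descent, as prescribed. -/
def IsStep {t : ℕ} (b : Bool) (x y : Fin t) : Prop := if b then x ≤ y else y ≤ x

/-- Splitting off the first entry and summing over the second reproduces the recursion of
`zigzagFrom`. -/
theorem card_zigzagFrom (c : ℤ → Bool) (t n : ℕ) (k : ℤ) (x : Fin t) :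
    Nat.card {a : Fin (n + 1) → Fin t //
      a 0 = x ∧ ∀ i : Fin n, IsStep (c (k + i)) (a i.castSucc) (a i.succ)} =
      zigzagFrom t (stepWord c n k) x := by
  induction n generalizing k x with
  | zero =>
    rw [stepWord, zigzagFrom, Nat.card_eq_one_iff_unique]
    refine ⟨⟨fun a b => Subtype.ext (funext fun i => ?_)⟩,
      ⟨⟨fun _ => x, rfl, fun i => i.elim0⟩⟩⟩
    rw [Fin.fin_one_eq_zero i, a.2.1, b.2.1]
  | succ n ih =>
    classical
    have e : {a : Fin (n + 1 + 1) → Fin t //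
        a 0 = x ∧ ∀ i : Fin (n + 1), IsStep (c (k + i)) (a i.castSucc) (a i.succ)} ≃
        Σ y : {y : Fin t // IsStep (c k) x y}, {a : Fin (n + 1) → Fin t //
          a 0 = y.1 ∧ ∀ i : Fin n, IsStep (c (k + 1 + i)) (a i.castSucc) (a i.succ)} :=
      { toFun := fun a => ⟨⟨a.1 1, by
            have := a.2.2 0
            rwa [Fin.castSucc_zero, a.2.1, Fin.val_zero, Nat.cast_zero, add_zero] at this⟩,
          ⟨fun i => a.1 i.succ, rfl, fun i => by
            have := a.2.2 i.succ
            rwa [Fin.val_succ, Nat.cast_succ, add_comm (i : ℤ), ← add_assoc] at this⟩⟩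
        invFun := fun p => ⟨Fin.cons x p.2.1, rfl, fun i => by
          cases i using Fin.cases with
          | zero =>
            have := p.1.2
            rw [← p.2.2.1] at this
            simpa using this
          | succ i =>
            have := p.2.2.2 i
            rw [Fin.val_succ, Nat.cast_succ, add_comm (i : ℤ), ← add_assoc]
            exact this⟩
        left_inv := fun a => Subtype.ext (funext fun i => by
          cases i using Fin.cases with
          | zero => exact a.2.1.symm
          | succ i => rfl)
        right_inv := by
          rintro ⟨⟨y, hy⟩, ⟨a, h, ha⟩⟩
          change a 0 = y at h
          subst h
          rfl }
    rw [Nat.card_congr e, Nat.card_sigma, Finset.sum_congr rfl fun y _ => ih (k + 1) y.1]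
    have hsub : ∀ (p : ℕ → Prop) [DecidablePred p] (q : Fin t → Prop) [Fintype {y // q y}]
        (g : ℕ → ℕ), (∀ y : Fin t, q y ↔ p y) →
        ∑ y : {y // q y}, g y.1 = ∑ y ∈ Finset.range t with p y, g y := by
      intro p _ q _ g hpq
      rw [Finset.sum_filter, ← Fin.sum_univ_eq_sum_range (fun y => if p y then g y else 0),
        ← Finset.sum_filter]
      exact (Finset.sum_subtype _ (by simp [hpq]) fun y : Fin t => g y).symm
    rw [stepWord]
    cases hc : c k
    · rw [zigzagFrom]
      rw [hsub (fun y => y ≤ x.1) _ (zigzagFrom t (stepWord c n (k + 1))) fun y => by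
        simp [IsStep]]
      refine Finset.sum_congr ?_ fun _ _ => rfl
      ext y
      have := x.2
      simp only [Finset.mem_filter, Finset.mem_range]
      omega
    · rw [zigzagFrom]
      rw [hsub (fun y => x.1 ≤ y) _ (zigzagFrom t (stepWord c n (k + 1))) fun y => by
        simp [IsStep]]
      refine Finset.sum_congr ?_ fun _ _ => rfl
      ext y
      simp only [Finset.mem_filter, Finset.mem_range, Finset.mem_Ico]
      omega

theorem pathRel_monotone_iff (c : ℤ → Bool) {t n : ℕ} (k : ℤ) (a : Fin (n + 1) → Fin t) :
    (∀ i j : Fin (n + 1), pathRel c (k + i) (k + j) → a i ≤ a j) ↔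
      ∀ i : Fin n, IsStep (c (k + i)) (a i.castSucc) (a i.succ) := by
  constructor
  · intro h i
    have hs : k + ((i.succ : ℕ) : ℤ) = k + ((i.castSucc : ℕ) : ℤ) + 1 := by
      rw [Fin.val_succ, Fin.val_castSucc]
      push_cast
      ring
    cases hc : c (k + i)
    · exact h i.succ i.castSucc (Or.inr ⟨hs, hc⟩)
    · exact h i.castSucc i.succ (Or.inl ⟨hs, hc⟩)
  · have key : ∀ i j : Fin (n + 1), k + (j : ℕ) = k + (i : ℕ) + 1 →
        ∃ l : Fin n, i = l.castSucc ∧ j = l.succ := fun i j hij =>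
      ⟨⟨i, by omega⟩, rfl, Fin.ext (by rw [Fin.val_succ]; simp only; omega)⟩
    rintro h i j (⟨hij, hc⟩ | ⟨hij, hc⟩)
    · obtain ⟨l, rfl, rfl⟩ := key i j hij
      have := h l
      rw [Fin.val_castSucc] at hc
      rwa [hc] at this
    · obtain ⟨l, rfl, rfl⟩ := key j i hij
      have := h l
      rw [Fin.val_castSucc] at hc
      rwa [hc] at this

theorem relCountOn_pathRel_Icc (c : ℤ → Bool) (t n : ℕ) (k : ℤ) :
    relCountOn (pathRel c) (Finset.Icc k (k + n)) t = zigzagCount (stepWord c n k) t := by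
  let e : Fin (n + 1) ≃ Finset.Icc k (k + n) :=
    { toFun := fun i => ⟨k + i, by rw [Finset.mem_Icc]; omega⟩
      invFun := fun x => ⟨(x.1 - k).toNat, by have := Finset.mem_Icc.1 x.2; omega⟩
      left_inv := fun i => by ext; simp
      right_inv := fun x => by
        have := Finset.mem_Icc.1 x.2
        apply Subtype.ext
        simp only
        omega }
  rw [relCountOn, ← relCount_congr (R := fun i j : Fin (n + 1) => pathRel c (k + i) (k + j)) e
    fun _ _ => Iff.rfl, zigzagCount, ← Fin.sum_univ_eq_sum_range,
    ← Finset.sum_congr rfl fun x _ => card_zigzagFrom c t n k x, ← Nat.card_sigma, relCount]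
  exact Nat.card_congr
    { toFun := fun a => ⟨a.1 0, a.1, rfl, (pathRel_monotone_iff c k a.1).1 a.2⟩
      invFun := fun p => ⟨p.2.1, (pathRel_monotone_iff c k p.2.1).2 p.2.2.2⟩
      left_inv := fun _ => rfl
      right_inv := by
        rintro ⟨_, ⟨a, rfl, ha⟩⟩
        rfl }

/-! ### Polynomiality and nonnegative coefficients -/

open Polynomial in
/-- The counts are polynomial, with nonnegative constant and linear coefficients. -/
theorem exists_pathRel_polynomial (c : ℤ → Bool) (S : Finset ℤ) :
    ∃ f : ℚ[X], (∀ t : ℕ, f.eval (t : ℚ) = relCountOn (pathRel c) S t) ∧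
      0 ≤ f.coeff 0 ∧ 0 ≤ f.coeff 1 := by
  induction S using Finset.strongInduction with
  | H S ih =>
  rcases S.eq_empty_or_nonempty with rfl | hS
  · exact ⟨1, by simp [relCountOn_empty], by simp, by simp [coeff_one]⟩
  have hk := S.min'_mem hS
  have hmin : ∀ x ∈ S, S.min' hS ≤ x := fun x hx => S.min'_le x hx
  generalize S.min' hS = k at hk hmin
  -- The maximal interval of `S` starting at its minimum is a path unrelated to the rest of `S`.
  have hex : ∃ n : ℕ, k + n + 1 ∉ S := by
    refine ⟨(S.max' hS - k).toNat, fun h => ?_⟩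
    have := S.le_max' _ h
    omega
  classical
  obtain ⟨n, hn, hlt⟩ : ∃ n : ℕ, k + n + 1 ∉ S ∧ ∀ m < n, k + (m : ℕ) + 1 ∈ S :=
    ⟨Nat.find hex, Nat.find_spec hex, fun m hm => not_not.1 (Nat.find_min hex hm)⟩
  have hI : Finset.Icc k (k + n) ⊆ S := by
    intro x hx
    rw [Finset.mem_Icc] at hx
    rcases hx.1.eq_or_lt with rfl | h
    · exact hk
    · have := hlt (x - k - 1).toNat (by omega)
      rwa [show k + ((x - k - 1).toNat : ℤ) + 1 = x by omega] at this
  have hkI : k ∈ Finset.Icc k (k + n) := by rw [Finset.mem_Icc]; omega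
  obtain ⟨f, hf, f0, f1⟩ := exists_zigzag_polynomial (stepWord c n k)
  obtain ⟨g, hg, g0, -⟩ := ih (S \ Finset.Icc k (k + n)) (Finset.sdiff_ssubset hI ⟨k, hkI⟩)
  refine ⟨f * g, fun t => ?_, by simp [mul_coeff_zero, f0], ?_⟩
  · rw [relCountOn_mul (pathRel c) hI, eval_mul, hf, hg, relCountOn_pathRel_Icc, Nat.cast_mul]
    intro x hx y hy
    rw [Finset.mem_sdiff, Finset.mem_Icc] at hy
    rw [Finset.mem_Icc] at hx
    have := hmin y hy.1
    have : y ≠ k + n + 1 := fun h => hn (h ▸ hy.1)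
    unfold pathRel
    omega
  · rw [mul_coeff_one, f0, zero_mul, zero_add, f1]
    positivity

open Polynomial in
/-- The derivative of the polynomial of `S` is the sum over lower parts `I` of the linear
coefficient for `I` times the polynomial of `S \ I`, so nonnegativity follows by induction. -/
theorem exists_pathRel_polynomial_nonneg (c : ℤ → Bool) (S : Finset ℤ) :
    ∃ f : ℚ[X], (∀ t : ℕ, f.eval (t : ℚ) = relCountOn (pathRel c) S t) ∧ ∀ k, 0 ≤ f.coeff k := by
  have eq_of_nat : ∀ f g : ℚ[X], (∀ t : ℕ, f.eval (t : ℚ) = g.eval (t : ℚ)) → f = g := by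
    intro f g h
    refine eq_of_infinite_eval_eq f g ((Set.infinite_range_of_injective
      (Nat.cast_injective (R := ℚ))).mono ?_)
    rintro _ ⟨t, rfl⟩
    exact h t
  choose f hf f0 f1 using exists_pathRel_polynomial c
  refine ⟨f S, hf S, ?_⟩
  have hder : ∀ S, derivative (f S) =
      ∑ I ∈ lowerParts (pathRel c) S, C ((f I).coeff 1) * f (S \ I) := by
    intro S
    refine eq_of_nat _ _ fun t => ?_
    -- With t fixed, the addition formula is an identity of polynomials in s; its linear coefficient
    -- is the derivative at t.
    have : taylor (t : ℚ) (f S) =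
        ∑ I ∈ lowerParts (pathRel c) S, f I * C ((f (S \ I)).eval (t : ℚ)) := by
      refine eq_of_nat _ _ fun s => ?_
      rw [taylor_eval, ← Nat.cast_add, hf, relCountOn_add, eval_finsetSum]
      simp [hf]
    rw [← taylor_coeff_one, this, finsetSum_coeff, eval_finsetSum]
    simp
  have hempty : f ∅ = 1 := eq_of_nat _ _ fun t => by simp [hf, relCountOn_empty]
  induction S using Finset.strongInduction with
  | H S ih =>
  intro k
  cases k with
  | zero => exact f0 S
  | succ k =>
    have h := congrArg (fun p => coeff p k) (hder S)
    simp only [coeff_derivative, finsetSum_coeff, coeff_C_mul] at h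
    refine nonneg_of_mul_nonneg_left (b := (k + 1 : ℚ)) ?_ (by positivity)
    rw [h]
    refine Finset.sum_nonneg fun I hI => ?_
    -- The term `I = ∅`, the only one involving `S` itself, vanishes because `f ∅ = 1` has no linear
    -- coefficient.
    rcases I.eq_empty_or_nonempty with rfl | hne
    · simp [hempty, coeff_one]
    · exact mul_nonneg (f1 I)
        (ih _ (Finset.sdiff_ssubset ((mem_lowerParts _).1 hI).1 hne) k)

/-! ### Ribbons as paths of contents -/

namespace SkewShape

variable (s : SkewShape)

theorem mem_cells_of_le {a b c : ℕ × ℕ} (ha : a ∈ s.cells) (hc : c ∈ s.cells) (hab : a ≤ b)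
    (hbc : b ≤ c) : b ∈ s.cells := by
  rw [cells, Finset.mem_sdiff] at *
  exact ⟨s.outer.isLowerSet hbc hc.1, fun h => ha.2 (s.inner.isLowerSet hab h)⟩

variable {s}

/-- Skew shapes are convex, so a box strictly below and to the right of another would force a 2 × 2
square. -/
theorem IsRibbon.not_lt_lt (hs : s.IsRibbon) {i j i' j' : ℕ} (h : (i, j) ∈ s.cells)
    (h' : (i', j') ∈ s.cells) (hi : i < i') : j' ≤ j := by
  by_contra! hj
  refine hs i j ⟨h, ?_, ?_, ?_⟩ <;>
    exact s.mem_cells_of_le h h' (Prod.mk_le_mk.2 (by omega)) (Prod.mk_le_mk.2 (by omega))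

/-- The content of a box. -/
def content (x : ℕ × ℕ) : ℤ := x.2 - x.1

theorem IsRibbon.content_injOn (hs : s.IsRibbon) {x y : ℕ × ℕ} (hx : x ∈ s.cells)
    (hy : y ∈ s.cells) (h : content x = content y) : x = y := by
  obtain ⟨i, j⟩ := x
  obtain ⟨i', j'⟩ := y
  simp only [content] at h
  rcases lt_trichotomy i i' with hi | rfl | hi
  · have := hs.not_lt_lt hx hy hi
    omega
  · congr
    omega
  · have := hs.not_lt_lt hy hx hi
    omega

theorem IsRibbon.eq_of_content_eq_add_one (hs : s.IsRibbon) {x y : ℕ × ℕ} (hx : x ∈ s.cells)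
    (hy : y ∈ s.cells) (h : content y = content x + 1) :
    y = (x.1, x.2 + 1) ∨ x = (y.1 + 1, y.2) := by
  obtain ⟨i, j⟩ := x
  obtain ⟨i', j'⟩ := y
  simp only [content, Prod.mk.injEq] at h ⊢
  have h₁ := hs.not_lt_lt hx hy
  have h₂ := hs.not_lt_lt hy hx
  omega

open Classical in
/-- Whether the box of content `k` lies directly below the box of content `k + 1`. -/
noncomputable def verticalStep (s : SkewShape) (k : ℤ) : Bool :=
  decide (∃ y ∈ s.cells, (y.1 + 1, y.2) ∈ s.cells ∧ content (y.1 + 1, y.2) = k)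

/-- As content grows by one, the path moves up the diagram (an ascent in the poset) or right (a
descent). Boxes of consecutive contents are always adjacent, so gaps between components create no
spurious relations. -/
theorem IsRibbon.isNext_iff (hs : s.IsRibbon) (x y : s.CellPoset) :
    s.IsNext y x ↔ pathRel s.verticalStep (content x.1) (content y.1) := by
  obtain ⟨x, hx⟩ := x
  obtain ⟨y, hy⟩ := y
  simp only [IsNext, pathRel, verticalStep, decide_eq_true_eq, decide_eq_false_iff_not]
  constructor
  · rintro (rfl | rfl)
    · exact Or.inl ⟨by simp only [content]; push_cast; ring, y, hy, hx, rfl⟩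
    · refine Or.inr ⟨by simp only [content]; push_cast; ring, ?_⟩
      -- The box `z` above `y` would share the content of the box to the right of `y`, hence equal
      -- it.
      rintro ⟨z, hz, hz', h⟩
      have hzy := hs.content_injOn hz' hy h
      have := hs.content_injOn hz hx (by rw [← hzy]; simp only [content]; push_cast; ring)
      rw [← hzy] at this
      have := congrArg Prod.fst this
      simp at this
  · rintro (⟨h, z, hz, hz', hzx⟩ | ⟨h, hv⟩)
    · have hzx' := hs.content_injOn hz' hx hzx
      have := hs.content_injOn hz hy (by
        rw [h, ← hzx]; simp only [content]; push_cast; ring)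
      left
      rw [← hzx', this]
    · rcases hs.eq_of_content_eq_add_one hy hx h with h' | h'
      · exact Or.inr h'
      · exact absurd ⟨x, hx, h' ▸ hy, by rw [← h']⟩ hv

/-- Since `IsNext` generates the order, monotonicity need only be tested on neighbouring boxes. -/
theorem IsRibbon.orderCount_eq (hs : s.IsRibbon) (t : ℕ) :
    orderCount s.CellPoset t =
      relCountOn (pathRel s.verticalStep) (s.cells.image content) t := by
  have he : Function.Bijective fun x : s.CellPoset =>
      (⟨content x.1, Finset.mem_image_of_mem _ x.2⟩ : s.cells.image content) := by
    constructor
    · intro x y h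
      exact Subtype.ext (hs.content_injOn x.2 y.2 (congrArg Subtype.val h))
    · rintro ⟨k, hk⟩
      obtain ⟨x, hx, rfl⟩ := Finset.mem_image.1 hk
      exact ⟨⟨x, hx⟩, rfl⟩
  rw [relCountOn, ← relCount_congr (R := fun x y : s.CellPoset => s.IsNext y x)
    (Equiv.ofBijective _ he) (hs.isNext_iff), orderCount, relCount]
  refine Nat.card_congr
    { toFun := fun f => ⟨f, fun x y h => f.monotone (Relation.ReflTransGen.single h)⟩
      invFun := fun a => ⟨a.1, fun x y h => ?_⟩
      left_inv := fun _ => rfl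
      right_inv := fun _ => rfl }
  change Relation.ReflTransGen s.IsNext y x at h
  induction h with
  | refl => exact le_rfl
  | tail _ h ih => exact (a.2 _ _ h).trans ih

end SkewShape

/-! ### Conclusion for fence posets -/

theorem orderCount_congr {P Q : Type*} [PartialOrder P] [PartialOrder Q] (e : P ≃o Q) (t : ℕ) :
    orderCount P t = orderCount Q t :=
  Nat.card_congr
    { toFun := fun f => f.comp (e.symm : Q →o P)
      invFun := fun f => f.comp (e : P →o Q)
      left_inv := fun f => by ext; simp
      right_inv := fun f => by ext; simp }

theorem corollary5p1 {P : Type*} [PartialOrder P] [Finite P] (hP : IsFencePoset P) :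
    ∀ k : ℕ, 0 ≤ (orderPolynomial P).coeff k := by
  obtain ⟨s, hs, ⟨e⟩⟩ := hP
  obtain ⟨f, hf, hnonneg⟩ :=
    exists_pathRel_polynomial_nonneg s.verticalStep (s.cells.image SkewShape.content)
  have : orderPolynomial P = f := (existsUnique_orderPolynomial P).unique
    (existsUnique_orderPolynomial P).choose_spec.1 fun t _ => by
      rw [hf, orderCount_congr e, hs.orderCount_eq]
  rwa [this]
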